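/- **Corollary (strong normalization of $\overline{\lambda}\mu\tilde{\mu}^*$ and $\overline{\lambda}\mu\tilde{\mu}$).** Fix a set $\mathcal A$ of atomic types. The types of the $\overline{\lambda}\mu\tilde{\mu}^*$-calculus are generated from atomic types by $A\to B$ and $A^\bot$, and are identified modulo the congruence generated by $(A^\bot)^\bot=A$. There are two kinds of variables, $l$-variables $x,y,\dots$ and $r$-variables $\alpha,\beta,\dots$, and three kinds of terms (up to renaming of bound variables), $c$-terms $p$, $l$-terms $t$ and $r$-terms $e$: $$p ::= \lfloor t,e\rfloor,\qquad t ::= x \mid \lambda x\,t \mid \mu\alpha\,p \mid \overline{e},\qquad e ::= \alpha \mid (t.e) \mid \tilde\mu x\,p \mid \widetilde{t}.$$ Let $\Gamma$ and $\triangle$ range over finite sets of declarations $x:A$ and $\alpha:A$ respectively, with each variable declared at most once. The judgements $\Gamma\rhd t:A\,|\,\triangle$, $\;\Gamma\,|\,e:A\rhd\triangle$ and $p:(\Gamma\rhd\triangle)$ are derived by the rules $$\frac{}{\Gamma,x:A\rhd x:A\,|\,\triangle}\qquad \frac{}{\Gamma\,|\,\alpha:A\rhd\alpha:A,\triangle}\qquad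 \frac{\Gamma,x:A\rhd t:B\,|\,\triangle}{\Gamma\rhd\lambda x\,t:A\to B\,|\,\triangle}\qquad \frac{\Gamma\rhd t:A\,|\,\triangle\quad \Gamma\,|\,e:B\rhd\triangle}{\Gamma\,|\,(t.e):A\to B\rhd\triangle}$$ $$\frac{\Gamma\rhd t:A\,|\,\triangle\quad \Gamma\,|\,e:A\rhd\triangle}{\lfloor t,e\rfloor:(\Gamma\rhd\triangle)}\qquad \frac{p:(\Gamma\rhd\alpha:A,\triangle)}{\Gamma\rhd\mu\alpha\,p:A\,|\,\triangle}\qquad \frac{p:(\Gamma,x:A\rhd\triangle)}{\Gamma\,|\,\tilde\mu x\,p:A\rhd\triangle}$$ $$\frac{\Gamma\,|\,e:A\rhd\triangle}{\Gamma\rhd\overline{e}:A^\bot\,|\,\triangle}\qquad \frac{\Gamma\rhd t:A\,|\,\triangle}{\Gamma\,|\,\widetilde{t}:A^\bot\rhd\triangle}.$$ One-step reduction $\hookrightarrow$ is the compatible closure of the union of the rules $$\lfloor\lambda x\,t,(t'.e)\rfloor\hookrightarrow\lfloor t',\tilde\mu x\lfloor t,e\rfloor\rfloor\ \ (x\notin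 Fv(e)),\qquad \lfloor\mu\alpha\,p,e\rfloor\hookrightarrow p[\alpha:=e],\qquad \lfloor t,\tilde\mu x\,p\rfloor\hookrightarrow p[x:=t],$$ $$\mu\alpha\lfloor t,\alpha\rfloor\hookrightarrow t\ \ (\alpha\notin Fv(t)),\qquad \tilde\mu x\lfloor x,e\rfloor\hookrightarrow e\ \ (x\notin Fv(e)),$$ $$\overline{\widetilde{t}}\hookrightarrow t,\qquad \widetilde{\overline{e}}\hookrightarrow e,\qquad \lfloor\overline{e},\widetilde{t}\rfloor\hookrightarrow\lfloor t,e\rfloor .$$ The $\overline{\lambda}\mu\tilde{\mu}$-calculus (implicational part) is obtained by omitting $A^\bot$, $\overline{e}$, $\widetilde{t}$ and the typing and reduction rules that mention them. Then every typed term of the $\overline{\lambda}\mu\tilde{\mu}^*$-calculus is strongly normalizable: if $\Gamma\rhd t:A\,|\,\triangle$ (resp. $\Gamma\,|\,e:A\rhd\triangle$, resp. $p:(\Gamma\rhd\triangle)$), then every $\hookrightarrow$-reduction sequence starting from $t$ (resp. $e$, resp. $p$) is finite. The same holds for every typed term of the $\overline{\lambda}\mu\tilde{\mu}$-calculus. 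-/

import Mathlib

/-! Two calculi are defined at once: the `λμμ̃`-calculus of Curien and Herbelin (implicational part)
and its extension `λμμ̃*` with an involutive negation. Everything that exists only in the extension
is indexed by `Calculus.star`. Terms are taken up to renaming of bound variables: they are
represented with de Bruijn indices, `l`-variables and `r`-variables being numbered separately. -/

namespace LMM

universe u

/-- `base` is `λμμ̃`, `star` is `λμμ̃*`. -/
inductive Calculus : Type
  | base
  | star

/-- The three kinds of terms: `l`-terms `t`, `r`-terms `e`, `c`-terms `p`. -/
inductive Kind : Type
  | l
  | r
  | c

/-! ### Types -/

/-- Type expressions: atomic types, arrows and (in `λμμ̃*` only) negations. -/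
inductive PreTy (𝒜 : Type u) : Calculus → Type u
  | atom {s : Calculus} (a : 𝒜) : PreTy 𝒜 s
  | arr {s : Calculus} (A B : PreTy 𝒜 s) : PreTy 𝒜 s
  | neg (A : PreTy 𝒜 .star) : PreTy 𝒜 .star

/-- One use of the equation `(A^⊥)^⊥ = A` inside a type expression. -/
inductive PreTy.Rel {𝒜 : Type u} : {s : Calculus} → PreTy 𝒜 s → PreTy 𝒜 s → Prop
  | neg_neg (A : PreTy 𝒜 .star) : PreTy.Rel (.neg (.neg A)) A
  | neg {A A' : PreTy 𝒜 .star} (h : PreTy.Rel A A') : PreTy.Rel (.neg A) (.neg A')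
  | arr_left {s : Calculus} {A A' : PreTy 𝒜 s} (B : PreTy 𝒜 s) (h : PreTy.Rel A A') :
      PreTy.Rel (.arr A B) (.arr A' B)
  | arr_right {s : Calculus} (A : PreTy 𝒜 s) {B B' : PreTy 𝒜 s} (h : PreTy.Rel B B') :
      PreTy.Rel (.arr A B) (.arr A B')

/-- Types: type expressions modulo the congruence generated by `(A^⊥)^⊥ = A`
(`Quot` divides by the equivalence relation that `PreTy.Rel` generates). -/
def Ty (𝒜 : Type u) (s : Calculus) : Type u := Quot (PreTy.Rel (𝒜 := 𝒜) (s := s))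

namespace Ty

variable {𝒜 : Type u} {s : Calculus}

def atom (a : 𝒜) : Ty 𝒜 s := Quot.mk _ (.atom a)

def arr : Ty 𝒜 s → Ty 𝒜 s → Ty 𝒜 s :=
  Quot.map₂ PreTy.arr (fun A _ _ h => .arr_right A h) (fun _ _ B h => .arr_left B h)

def neg : Ty 𝒜 .star → Ty 𝒜 .star :=
  Quot.map PreTy.neg (fun _ _ h => .neg h)

theorem neg_neg (A : Ty 𝒜 .star) : neg (neg A) = A := by
  induction A using Quot.ind with
  | _ A => exact Quot.sound (.neg_neg A)

end Ty

/-! ### Terms -/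

/-- Terms. `lam` and `mutilde` (that is, `μ̃`) bind the `l`-variable `0` of their body,
`mu` binds the `r`-variable `0`. -/
inductive Tm : Calculus → Kind → Type
  /-- `⌊t, e⌋` -/
  | cut {s : Calculus} (t : Tm s .l) (e : Tm s .r) : Tm s .c
  /-- an `l`-variable `x` -/
  | lvar {s : Calculus} (x : ℕ) : Tm s .l
  /-- `λx t` -/
  | lam {s : Calculus} (t : Tm s .l) : Tm s .l
  /-- `μα p` -/
  | mu {s : Calculus} (p : Tm s .c) : Tm s .l
  /-- `e̅`, in `λμμ̃*` only -/
  | bar (e : Tm .star .r) : Tm .star .l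
  /-- an `r`-variable `α` -/
  | rvar {s : Calculus} (a : ℕ) : Tm s .r
  /-- `(t.e)` -/
  | app {s : Calculus} (t : Tm s .l) (e : Tm s .r) : Tm s .r
  /-- `μ̃x p` -/
  | mutilde {s : Calculus} (p : Tm s .c) : Tm s .r
  /-- `t̃`, in `λμμ̃*` only -/
  | tilde (t : Tm .star .l) : Tm .star .r

/-- The renaming `ρ` pushed under a binder. -/
def upRen (ρ : ℕ → ℕ) : ℕ → ℕ
  | 0 => 0
  | n + 1 => ρ n + 1

namespace Tm

/-- Rename the free `l`-variables by `ρ` and the free `r`-variables by `θ`. -/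
def rename : {s : Calculus} → {k : Kind} → (ρ θ : ℕ → ℕ) → Tm s k → Tm s k
  | _, _, ρ, θ, cut t e => cut (rename ρ θ t) (rename ρ θ e)
  | _, _, ρ, _, lvar x => lvar (ρ x)
  | _, _, ρ, θ, lam t => lam (rename (upRen ρ) θ t)
  | _, _, ρ, θ, mu p => mu (rename ρ (upRen θ) p)
  | _, _, ρ, θ, bar e => bar (rename ρ θ e)
  | _, _, _, θ, rvar a => rvar (θ a)
  | _, _, ρ, θ, app t e => app (rename ρ θ t) (rename ρ θ e)
  | _, _, ρ, θ, mutilde p => mutilde (rename (upRen ρ) θ p)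
  | _, _, ρ, θ, tilde t => tilde (rename ρ θ t)

variable {s : Calculus} {k : Kind}

/-- `u` weakened by a fresh `l`-variable `0`. The terms of the form `shiftL u` are
exactly those in which the `l`-variable `0` is not free. -/
def shiftL (u : Tm s k) : Tm s k := rename Nat.succ id u

/-- `u` weakened by a fresh `r`-variable `0`. The terms of the form `shiftR u` are
exactly those in which the `r`-variable `0` is not free. -/
def shiftR (u : Tm s k) : Tm s k := rename id Nat.succ u

/-- The sequence `u, f 0, f 1, …`. -/
def scons (u : Tm s k) (f : ℕ → Tm s k) : ℕ → Tm s k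
  | 0 => u
  | n + 1 => f n

/-- Simultaneous capture-avoiding substitution of `σ` for the `l`-variables and `τ` for the
`r`-variables. -/
def subst : {s : Calculus} → {k : Kind} → (σ : ℕ → Tm s .l) → (τ : ℕ → Tm s .r) → Tm s k → Tm s k
  | _, _, σ, τ, cut t e => cut (subst σ τ t) (subst σ τ e)
  | _, _, σ, _, lvar x => σ x
  | _, _, σ, τ, lam t =>
      lam (subst (scons (lvar 0) fun n => shiftL (σ n)) (fun n => shiftL (τ n)) t)
  | _, _, σ, τ, mu p =>
      mu (subst (fun n => shiftR (σ n)) (scons (rvar 0) fun n => shiftR (τ n)) p)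
  | _, _, σ, τ, bar e => bar (subst σ τ e)
  | _, _, _, τ, rvar a => τ a
  | _, _, σ, τ, app t e => app (subst σ τ t) (subst σ τ e)
  | _, _, σ, τ, mutilde p =>
      mutilde (subst (scons (lvar 0) fun n => shiftL (σ n)) (fun n => shiftL (τ n)) p)
  | _, _, σ, τ, tilde t => tilde (subst σ τ t)

/-- `u[x := t]`, where `x` is the `l`-variable `0` (which disappears). -/
def instL (u : Tm s k) (t : Tm s .l) : Tm s k := subst (scons t lvar) rvar u

/-- `u[α := e]`, where `α` is the `r`-variable `0` (which disappears). -/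
def instR (u : Tm s k) (e : Tm s .r) : Tm s k := subst lvar (scons e rvar) u

end Tm

/-! ### Typing -/

/-- Contexts: the variable with index `n` is declared with the `n`-th type of the list. -/
abbrev Ctx (𝒜 : Type u) (s : Calculus) : Type u := List (Ty 𝒜 s)

mutual

/-- `Γ ▷ t : A | Δ` -/
inductive TypedL {𝒜 : Type u} : {s : Calculus} → Ctx 𝒜 s → Tm s .l → Ty 𝒜 s → Ctx 𝒜 s → Prop
  | var {s : Calculus} {Γ Δ : Ctx 𝒜 s} {x : ℕ} {A : Ty 𝒜 s} (h : Γ[x]? = some A) :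
      TypedL Γ (.lvar x) A Δ
  | lam {s : Calculus} {Γ Δ : Ctx 𝒜 s} {t : Tm s .l} {A B : Ty 𝒜 s} (h : TypedL (A :: Γ) t B Δ) :
      TypedL Γ (.lam t) (.arr A B) Δ
  | mu {s : Calculus} {Γ Δ : Ctx 𝒜 s} {p : Tm s .c} {A : Ty 𝒜 s} (h : TypedC p Γ (A :: Δ)) :
      TypedL Γ (.mu p) A Δ
  | bar {Γ Δ : Ctx 𝒜 .star} {e : Tm .star .r} {A : Ty 𝒜 .star} (h : TypedR Γ e A Δ) :
      TypedL Γ (.bar e) (.neg A) Δ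

/-- `Γ | e : A ▷ Δ` -/
inductive TypedR {𝒜 : Type u} : {s : Calculus} → Ctx 𝒜 s → Tm s .r → Ty 𝒜 s → Ctx 𝒜 s → Prop
  | var {s : Calculus} {Γ Δ : Ctx 𝒜 s} {a : ℕ} {A : Ty 𝒜 s} (h : Δ[a]? = some A) :
      TypedR Γ (.rvar a) A Δ
  | app {s : Calculus} {Γ Δ : Ctx 𝒜 s} {t : Tm s .l} {e : Tm s .r} {A B : Ty 𝒜 s}
      (ht : TypedL Γ t A Δ) (he : TypedR Γ e B Δ) : TypedR Γ (.app t e) (.arr A B) Δ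
  | mutilde {s : Calculus} {Γ Δ : Ctx 𝒜 s} {p : Tm s .c} {A : Ty 𝒜 s} (h : TypedC p (A :: Γ) Δ) :
      TypedR Γ (.mutilde p) A Δ
  | tilde {Γ Δ : Ctx 𝒜 .star} {t : Tm .star .l} {A : Ty 𝒜 .star} (h : TypedL Γ t A Δ) :
      TypedR Γ (.tilde t) (.neg A) Δ

/-- `p : (Γ ▷ Δ)` -/
inductive TypedC {𝒜 : Type u} : {s : Calculus} → Tm s .c → Ctx 𝒜 s → Ctx 𝒜 s → Prop
  | cut {s : Calculus} {Γ Δ : Ctx 𝒜 s} {t : Tm s .l} {e : Tm s .r} {A : Ty 𝒜 s}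
      (ht : TypedL Γ t A Δ) (he : TypedR Γ e A Δ) : TypedC (.cut t e) Γ Δ

end

/-! ### Reduction -/

open Tm in
/-- The reduction rules; the last three exist in `λμμ̃*` only. -/
inductive Root : {s : Calculus} → {k : Kind} → Tm s k → Tm s k → Prop
  | lam {s : Calculus} (t t' : Tm s .l) (e : Tm s .r) :
      Root (cut (lam t) (app t' e)) (cut t' (mutilde (cut t (shiftL e))))
  | mu {s : Calculus} (p : Tm s .c) (e : Tm s .r) : Root (cut (mu p) e) (instR p e)
  | mutilde {s : Calculus} (t : Tm s .l) (p : Tm s .c) : Root (cut t (mutilde p)) (instL p t)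
  | sl {s : Calculus} (t : Tm s .l) : Root (mu (cut (shiftR t) (rvar 0))) t
  | sr {s : Calculus} (e : Tm s .r) : Root (mutilde (cut (lvar 0) (shiftL e))) e
  | cl1l (t : Tm .star .l) : Root (bar (tilde t)) t
  | cl1r (e : Tm .star .r) : Root (tilde (bar e)) e
  | cl2 (t : Tm .star .l) (e : Tm .star .r) : Root (cut (bar e) (tilde t)) (cut t e)

open Tm in
/-- One-step reduction: the compatible closure of the union of the rules. -/
inductive Step : {s : Calculus} → {k : Kind} → Tm s k → Tm s k → Prop
  | root {s : Calculus} {k : Kind} {u v : Tm s k} (h : Root u v) : Step u v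
  | cut_left {s : Calculus} {t t' : Tm s .l} (e : Tm s .r) (h : Step t t') :
      Step (cut t e) (cut t' e)
  | cut_right {s : Calculus} (t : Tm s .l) {e e' : Tm s .r} (h : Step e e') :
      Step (cut t e) (cut t e')
  | lam {s : Calculus} {t t' : Tm s .l} (h : Step t t') : Step (lam t) (lam t')
  | mu {s : Calculus} {p p' : Tm s .c} (h : Step p p') : Step (mu p) (mu p')
  | bar {e e' : Tm .star .r} (h : Step e e') : Step (bar e) (bar e')
  | app_left {s : Calculus} {t t' : Tm s .l} (e : Tm s .r) (h : Step t t') :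
      Step (app t e) (app t' e)
  | app_right {s : Calculus} (t : Tm s .l) {e e' : Tm s .r} (h : Step e e') :
      Step (app t e) (app t e')
  | mutilde {s : Calculus} {p p' : Tm s .c} (h : Step p p') : Step (mutilde p) (mutilde p')
  | tilde {t t' : Tm .star .l} (h : Step t t') : Step (tilde t) (tilde t')

/-- Strong normalizability: every reduction sequence starting from `u` is finite. -/
def StronglyNormalizable {s : Calculus} {k : Kind} (u : Tm s k) : Prop :=
  ¬ ∃ f : ℕ → Tm s k, f 0 = u ∧ ∀ n, Step (f n) (f (n + 1))

/-- Every typed term of the calculus `s`, of any of the three kinds, is strongly normalizable. -/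
def CalculusStronglyNormalizable (𝒜 : Type u) (s : Calculus) : Prop :=
  (∀ (Γ Δ : Ctx 𝒜 s) (t : Tm s .l) (A : Ty 𝒜 s), TypedL Γ t A Δ → StronglyNormalizable t) ∧
  (∀ (Γ Δ : Ctx 𝒜 s) (e : Tm s .r) (A : Ty 𝒜 s), TypedR Γ e A Δ → StronglyNormalizable e) ∧
  (∀ (Γ Δ : Ctx 𝒜 s) (p : Tm s .c), TypedC p Γ Δ → StronglyNormalizable p)

end LMM

/-! Erasing both negations and the distinction between `l`- and `r`-terms turns either calculus into
a one-sorted calculus in which `A^⊥` is interpreted by exchanging the two halves of the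
interpretation of `A`, so that `(A^⊥)^⊥ = A` holds on the nose. The erasure simulates every rule
except the three negation rules; those shrink the term and change its erasure at most by exchanging
the two sides of cuts, which commutes with reduction.

A critical pair `⌊μα p, μ̃x q⌋` contracts in two unrelated ways, so membership of a `μ`-abstraction
in one half of a reducibility candidate refers to the other half and conversely. Following Barbanera
and Berardi, this circularity is resolved by a fixed point: each half depends antitonically on the
other, hence monotonically on itself. -/

namespace LMM

universe u

theorem acc_of_simulation {α β γ : Type*} [LT γ] [WellFoundedLT γ] {r : α → α → Prop}
    {s : β → β → Prop} (sim : α → β → Prop) (size : α → γ)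
    (h : ∀ {a a' b}, sim a b → r a' a → (∃ b', s b' b ∧ sim a' b') ∨ sim a' b ∧ size a' < size a)
    {a : α} {b : β} (hb : Acc s b) (hab : sim a b) : Acc r a := by
  induction hb generalizing a with
  | intro b _ ihb =>
    induction a using (InvImage.wf size wellFounded_lt).induction with
    | _ a iha =>
      refine ⟨_, fun a' ha' => ?_⟩
      obtain ⟨b', hb', hab'⟩ | ⟨hab', hlt⟩ := h hab ha'
      · exact ihb b' hb' hab'
      · exact iha a' hlt hab'

/-! ### The one-sorted symmetric calculus -/

/-- Terms of the one-sorted symmetric calculus, the target of the erasure: `mu` stands for both `μ`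
and `μ̃`, and `pair` for `(t.e)`. Both `lam` and `mu` bind the variable `0` of their body. -/
inductive SymTm : Type
  | var (n : ℕ)
  | lam (t : SymTm)
  | mu (p : SymTm)
  | pair (t e : SymTm)
  | cut (t e : SymTm)

namespace SymTm

/-- Rename the free variables by `ρ`. -/
def rename : (ρ : ℕ → ℕ) → SymTm → SymTm
  | ρ, var n => var (ρ n)
  | ρ, lam t => lam (rename (upRen ρ) t)
  | ρ, mu p => mu (rename (upRen ρ) p)
  | ρ, pair t e => pair (rename ρ t) (rename ρ e)
  | ρ, cut t e => cut (rename ρ t) (rename ρ e)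

/-- The term `u` weakened by a fresh variable `0`. -/
def shift (u : SymTm) : SymTm := rename Nat.succ u

/-- The sequence `u, f 0, f 1, …`. -/
def scons (u : SymTm) (f : ℕ → SymTm) : ℕ → SymTm
  | 0 => u
  | n + 1 => f n

/-- The substitution `σ` pushed under a binder. -/
def up (σ : ℕ → SymTm) : ℕ → SymTm := scons (var 0) (shift ∘ σ)

/-- Simultaneous capture-avoiding substitution of `σ` for the variables. -/
def subst : (σ : ℕ → SymTm) → SymTm → SymTm
  | σ, var n => σ n
  | σ, lam t => lam (subst (up σ) t)
  | σ, mu p => mu (subst (up σ) p)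
  | σ, pair t e => pair (subst σ t) (subst σ e)
  | σ, cut t e => cut (subst σ t) (subst σ e)

/-- The term `p` with `v` substituted for the variable `0`, which disappears. -/
def inst (p v : SymTm) : SymTm := subst (scons v var) p

theorem upRen_comp_upRen (ρ ρ' : ℕ → ℕ) : upRen ρ ∘ upRen ρ' = upRen (ρ ∘ ρ') := by
  funext n; cases n <;> rfl

theorem rename_rename (ρ ρ' : ℕ → ℕ) (u : SymTm) :
    rename ρ (rename ρ' u) = rename (ρ ∘ ρ') u := by
  induction u generalizing ρ ρ' <;> simp only [rename, upRen_comp_upRen, Function.comp_apply, *]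

theorem rename_upRen_shift (ρ : ℕ → ℕ) (u : SymTm) :
    rename (upRen ρ) (shift u) = shift (rename ρ u) := by
  simp only [shift, rename_rename]; rfl

theorem up_comp_upRen (σ : ℕ → SymTm) (ρ : ℕ → ℕ) : up σ ∘ upRen ρ = up (σ ∘ ρ) := by
  funext n; cases n <;> rfl

theorem subst_rename (σ : ℕ → SymTm) (ρ : ℕ → ℕ) (u : SymTm) :
    subst σ (rename ρ u) = subst (σ ∘ ρ) u := by
  induction u generalizing σ ρ <;> simp only [rename, subst, up_comp_upRen, Function.comp_apply, *]

theorem rename_upRen_comp_up (ρ : ℕ → ℕ) (σ : ℕ → SymTm) :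
    rename (upRen ρ) ∘ up σ = up (rename ρ ∘ σ) := by
  funext n
  cases n with
  | zero => rfl
  | succ n => exact rename_upRen_shift ρ (σ n)

theorem rename_subst (ρ : ℕ → ℕ) (σ : ℕ → SymTm) (u : SymTm) :
    rename ρ (subst σ u) = subst (rename ρ ∘ σ) u := by
  induction u generalizing σ ρ <;>
    simp only [rename, subst, rename_upRen_comp_up, Function.comp_apply, *]

theorem subst_up_shift (σ : ℕ → SymTm) (u : SymTm) :
    subst (up σ) (shift u) = shift (subst σ u) := by
  simp only [shift, subst_rename, rename_subst]; rfl

theorem subst_up_comp_up (σ τ : ℕ → SymTm) : subst (up σ) ∘ up τ = up (subst σ ∘ τ) := by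
  funext n
  cases n with
  | zero => rfl
  | succ n => exact subst_up_shift σ (τ n)

theorem subst_up_comp_shift_comp (σ τ : ℕ → SymTm) :
    subst (up σ) ∘ shift ∘ τ = shift ∘ subst σ ∘ τ :=
  funext fun n => subst_up_shift σ (τ n)

theorem subst_subst (σ τ : ℕ → SymTm) (u : SymTm) :
    subst σ (subst τ u) = subst (subst σ ∘ τ) u := by
  induction u generalizing σ τ <;> simp only [subst, subst_up_comp_up, Function.comp_apply, *]

theorem up_var : up var = var := by
  funext n; cases n <;> rfl

theorem subst_var (u : SymTm) : subst var u = u := by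
  induction u <;> simp only [subst, up_var, *]

theorem shift_eq_subst (u : SymTm) : shift u = subst (var ∘ Nat.succ) u := by
  rw [← subst_rename, subst_var, shift]

theorem inst_shift (u v : SymTm) : inst (shift u) v = u := by
  rw [inst, shift, subst_rename]; exact subst_var u

theorem inst_comp_up (σ : ℕ → SymTm) (v : SymTm) : (inst · v) ∘ up σ = scons v σ := by
  funext n
  cases n with
  | zero => rfl
  | succ n => exact inst_shift (σ n) v

theorem inst_subst_up (σ : ℕ → SymTm) (p v : SymTm) :
    inst (subst (up σ) p) v = subst (scons v σ) p := by
  rw [← inst_comp_up, inst, subst_subst]; rfl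

theorem subst_inst (σ : ℕ → SymTm) (p v : SymTm) :
    subst σ (inst p v) = inst (subst (up σ) p) (subst σ v) := by
  rw [inst_subst_up, inst, subst_subst]
  congr 1
  funext n; cases n <;> rfl

/-- `Contracts t e u`: the cut of `t` against `e` is a redex headed by `t`, with contractum `u`. -/
inductive Contracts : SymTm → SymTm → SymTm → Prop
  | lam_pair (t t' e : SymTm) : Contracts (lam t) (pair t' e) (cut t' (mu (cut t (shift e))))
  | mu (p v : SymTm) : Contracts (mu p) v (inst p v)

/-- One-step reduction of the symmetric calculus. The rules are symmetric in the two sides of a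
cut. -/
inductive Step : SymTm → SymTm → Prop
  | cut {t e u : SymTm} (h : Contracts t e u) : Step (cut t e) u
  | cut_symm {t e u : SymTm} (h : Contracts t e u) : Step (cut e t) u
  | eta (t : SymTm) : Step (mu (.cut (shift t) (var 0))) t
  | eta_symm (t : SymTm) : Step (mu (.cut (var 0) (shift t))) t
  | lam {t t' : SymTm} (h : Step t t') : Step (lam t) (lam t')
  | mu {p p' : SymTm} (h : Step p p') : Step (mu p) (mu p')
  | pair_left {t t' : SymTm} (e : SymTm) (h : Step t t') : Step (pair t e) (pair t' e)
  | pair_right (t : SymTm) {e e' : SymTm} (h : Step e e') : Step (pair t e) (pair t e')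
  | cut_left {t t' : SymTm} (e : SymTm) (h : Step t t') : Step (.cut t e) (.cut t' e)
  | cut_right (t : SymTm) {e e' : SymTm} (h : Step e e') : Step (.cut t e) (.cut t e')

theorem Contracts.subst {t e u : SymTm} (h : Contracts t e u) (σ : ℕ → SymTm) :
    Contracts (t.subst σ) (e.subst σ) (u.subst σ) := by
  cases h with
  | lam_pair t t' e => simp only [SymTm.subst, subst_up_shift]; exact .lam_pair _ _ _
  | mu p v => rw [subst_inst]; exact .mu _ _

theorem Step.subst {u v : SymTm} (h : Step u v) (σ : ℕ → SymTm) :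
    Step (u.subst σ) (v.subst σ) := by
  induction h generalizing σ with
  | cut h => exact .cut (h.subst σ)
  | cut_symm h => exact .cut_symm (h.subst σ)
  | eta t => simp only [SymTm.subst, subst_up_shift]; exact .eta _
  | eta_symm t => simp only [SymTm.subst, subst_up_shift]; exact .eta_symm _
  | lam _ ih => exact .lam (ih _)
  | mu _ ih => exact .mu (ih _)
  | pair_left e _ ih => exact .pair_left _ (ih σ)
  | pair_right t _ ih => exact .pair_right _ (ih σ)
  | cut_left e _ ih => exact .cut_left _ (ih σ)
  | cut_right t _ ih => exact .cut_right _ (ih σ)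

theorem Step.shift {u v : SymTm} (h : Step u v) : Step u.shift v.shift := by
  simpa only [shift_eq_subst] using h.subst _

/-! ### Exchanging the two sides of cuts -/

/-- Equality up to exchanging the two sides of any number of cuts. -/
inductive Swap : SymTm → SymTm → Prop
  | var (n : ℕ) : Swap (var n) (var n)
  | lam {t t' : SymTm} (ht : Swap t t') : Swap (lam t) (lam t')
  | mu {p p' : SymTm} (hp : Swap p p') : Swap (mu p) (mu p')
  | pair {t t' e e' : SymTm} (ht : Swap t t') (he : Swap e e') : Swap (pair t e) (pair t' e')
  | cut {t t' e e' : SymTm} (ht : Swap t t') (he : Swap e e') : Swap (cut t e) (cut t' e')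
  | exch {t t' e e' : SymTm} (ht : Swap t t') (he : Swap e e') : Swap (cut t e) (cut e' t')

namespace Swap

theorem refl (u : SymTm) : Swap u u := by
  induction u with
  | var n => exact .var n
  | lam t ih => exact .lam ih
  | mu p ih => exact .mu ih
  | pair t e iht ihe => exact .pair iht ihe
  | cut t e iht ihe => exact .cut iht ihe

theorem symm {u v : SymTm} (h : Swap u v) : Swap v u := by
  induction h with
  | var n => exact .var n
  | lam _ ih => exact .lam ih
  | mu _ ih => exact .mu ih
  | pair _ _ iht ihe => exact .pair iht ihe
  | cut _ _ iht ihe => exact .cut iht ihe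
  | exch _ _ iht ihe => exact .exch ihe iht

theorem trans {u v w : SymTm} (huv : Swap u v) (hvw : Swap v w) : Swap u w := by
  induction huv generalizing w with
  | var n => exact hvw
  | lam _ ih => cases hvw with | lam ht => exact .lam (ih ht)
  | mu _ ih => cases hvw with | mu hp => exact .mu (ih hp)
  | pair _ _ iht ihe => cases hvw with | pair ht he => exact .pair (iht ht) (ihe he)
  | cut _ _ iht ihe =>
    cases hvw with
    | cut ht he => exact .cut (iht ht) (ihe he)
    | exch ht he => exact .exch (iht ht) (ihe he)
  | exch _ _ iht ihe =>
    cases hvw with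
    | cut he ht => exact .exch (iht ht) (ihe he)
    | exch he ht => exact .cut (iht ht) (ihe he)

theorem rename {u v : SymTm} (h : Swap u v) (ρ : ℕ → ℕ) : Swap (u.rename ρ) (v.rename ρ) := by
  induction h generalizing ρ with
  | var n => exact .var _
  | lam _ ih => exact .lam (ih _)
  | mu _ ih => exact .mu (ih _)
  | pair _ _ iht ihe => exact .pair (iht ρ) (ihe ρ)
  | cut _ _ iht ihe => exact .cut (iht ρ) (ihe ρ)
  | exch _ _ iht ihe => exact .exch (iht ρ) (ihe ρ)

theorem up {σ τ : ℕ → SymTm} (h : ∀ n, Swap (σ n) (τ n)) : ∀ n, Swap (up σ n) (up τ n)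
  | 0 => .var 0
  | n + 1 => (h n).rename _

theorem subst {u v : SymTm} (h : Swap u v) {σ τ : ℕ → SymTm} (hστ : ∀ n, Swap (σ n) (τ n)) :
    Swap (u.subst σ) (v.subst τ) := by
  induction h generalizing σ τ with
  | var n => exact hστ n
  | lam _ ih => exact .lam (ih (up hστ))
  | mu _ ih => exact .mu (ih (up hστ))
  | pair _ _ iht ihe => exact .pair (iht hστ) (ihe hστ)
  | cut _ _ iht ihe => exact .cut (iht hστ) (ihe hστ)
  | exch _ _ iht ihe => exact .exch (iht hστ) (ihe hστ)

theorem inst {p p' v v' : SymTm} (hp : Swap p p') (hv : Swap v v') :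
    Swap (p.inst v) (p'.inst v') :=
  hp.subst fun
    | 0 => hv
    | n + 1 => .var n

theorem exists_of_cut {t e v : SymTm} (h : Swap (.cut t e) v) :
    ∃ t' e', Swap t t' ∧ Swap e e' ∧ (v = .cut t' e' ∨ v = .cut e' t') := by
  cases h with
  | cut ht he => exact ⟨_, _, ht, he, .inl rfl⟩
  | exch ht he => exact ⟨_, _, ht, he, .inr rfl⟩

theorem exists_of_rename {ρ : ℕ → ℕ} {u v : SymTm} (h : Swap (u.rename ρ) v) :
    ∃ w, v = w.rename ρ ∧ Swap u w := by
  induction u generalizing ρ v with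
  | var n => cases h with | var => exact ⟨.var n, rfl, .var n⟩
  | lam t ih =>
    cases h with | lam ht =>
    obtain ⟨t', rfl, ht'⟩ := ih ht
    exact ⟨.lam t', rfl, .lam ht'⟩
  | mu p ih =>
    cases h with | mu hp =>
    obtain ⟨p', rfl, hp'⟩ := ih hp
    exact ⟨.mu p', rfl, .mu hp'⟩
  | pair t e iht ihe =>
    cases h with | pair ht he =>
    obtain ⟨t', rfl, ht'⟩ := iht ht
    obtain ⟨e', rfl, he'⟩ := ihe he
    exact ⟨.pair t' e', rfl, .pair ht' he'⟩
  | cut t e iht ihe =>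
    obtain ⟨_, _, ht, he, hv⟩ := exists_of_cut h
    obtain ⟨t', rfl, ht'⟩ := iht ht
    obtain ⟨e', rfl, he'⟩ := ihe he
    obtain rfl | rfl := hv
    · exact ⟨.cut t' e', rfl, .cut ht' he'⟩
    · exact ⟨.cut e' t', rfl, .exch ht' he'⟩

theorem exists_eta {t v : SymTm} (h : Swap (.mu (.cut t.shift (.var 0))) v) :
    ∃ t', Step v t' ∧ Swap t t' := by
  cases h with | mu h =>
  obtain ⟨_, _, ht, ⟨⟩, hv⟩ := exists_of_cut h
  obtain ⟨t', rfl, ht'⟩ := exists_of_rename ht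
  obtain rfl | rfl := hv
  · exact ⟨t', .eta t', ht'⟩
  · exact ⟨t', .eta_symm t', ht'⟩

theorem exists_contracts {t t' e e' u : SymTm} (h : Contracts t e u) (ht : Swap t t')
    (he : Swap e e') : ∃ u', Contracts t' e' u' ∧ Swap u u' := by
  cases h with
  | lam_pair =>
    cases ht with | lam ht =>
    cases he with | pair ht' he =>
    exact ⟨_, .lam_pair _ _ _, .cut ht' (.mu (.cut ht (he.rename _)))⟩
  | mu => cases ht with | mu hp => exact ⟨_, .mu _ _, hp.inst he⟩

theorem exists_cut_step {t e u v : SymTm} (h : Contracts t e u) (hv : Swap (.cut t e) v) :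
    ∃ u', Step v u' ∧ Swap u u' := by
  obtain ⟨_, _, ht, he, rfl | rfl⟩ := exists_of_cut hv
  · exact (exists_contracts h ht he).imp fun _ => .imp_left .cut
  · exact (exists_contracts h ht he).imp fun _ => .imp_left .cut_symm

theorem exists_step {u u' v : SymTm} (hs : Step u u') (h : Swap u v) :
    ∃ v', Step v v' ∧ Swap u' v' := by
  induction hs generalizing v with
  | cut hc => exact exists_cut_step hc h
  | cut_symm hc => exact exists_cut_step hc (.trans (.exch (.refl _) (.refl _)) h)
  | eta t => exact exists_eta h
  | eta_symm t => exact exists_eta (.trans (.mu (.exch (.refl _) (.refl _))) h)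
  | lam _ ih =>
    cases h with | lam ht =>
    obtain ⟨w, hs, hw⟩ := ih ht
    exact ⟨_, .lam hs, .lam hw⟩
  | mu _ ih =>
    cases h with | mu hp =>
    obtain ⟨w, hs, hw⟩ := ih hp
    exact ⟨_, .mu hs, .mu hw⟩
  | pair_left e _ ih =>
    cases h with | pair ht he =>
    obtain ⟨w, hs, hw⟩ := ih ht
    exact ⟨_, .pair_left _ hs, .pair hw he⟩
  | pair_right t _ ih =>
    cases h with | pair ht he =>
    obtain ⟨w, hs, hw⟩ := ih he
    exact ⟨_, .pair_right _ hs, .pair ht hw⟩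
  | cut_left e _ ih =>
    obtain ⟨_, _, ht, he, rfl | rfl⟩ := exists_of_cut h <;> obtain ⟨w, hs, hw⟩ := ih ht
    · exact ⟨_, .cut_left _ hs, .cut hw he⟩
    · exact ⟨_, .cut_right _ hs, .exch hw he⟩
  | cut_right t _ ih =>
    obtain ⟨_, _, ht, he, rfl | rfl⟩ := exists_of_cut h <;> obtain ⟨w, hs, hw⟩ := ih he
    · exact ⟨_, .cut_right _ hs, .cut ht hw⟩
    · exact ⟨_, .cut_left _ hs, .exch ht hw⟩

end Swap

/-! ### Strongly normalizing terms -/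

/-- Strong normalizability of terms of the symmetric calculus. -/
def SN (u : SymTm) : Prop := Acc (fun v u => Step u v) u

namespace SN

theorem step {u v : SymTm} (h : SN u) (hs : Step u v) : SN v := h.inv hs

theorem of_swap {u v : SymTm} (h : SN u) (huv : Swap u v) : SN v :=
  acc_of_simulation Swap (fun _ => 0) (fun hw hs => .inl (Swap.exists_step hs hw)) h huv.symm

theorem cut_comm {t e : SymTm} (h : SN (cut t e)) : SN (cut e t) :=
  h.of_swap (.exch (.refl t) (.refl e))

theorem of_map (f : SymTm → SymTm) (hf : ∀ {u v}, Step u v → Step (f u) (f v)) {u : SymTm}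
    (h : SN (f u)) : SN u :=
  RelHomClass.acc (⟨f, hf⟩ : (fun v u => Step u v) →r fun v u => Step u v) u h

theorem of_inst {p v : SymTm} (h : SN (p.inst v)) : SN p := of_map (·.inst v) (·.subst _) h

theorem of_cut_left {t e : SymTm} (h : SN (cut t e)) : SN t := of_map (cut · e) (.cut_left e) h

theorem lam {t : SymTm} (h : SN t) : SN (lam t) := by
  induction h with
  | intro t _ ih => exact ⟨_, fun _ hs => by cases hs with | lam hs => exact ih _ hs⟩

theorem pair {t e : SymTm} (ht : SN t) (he : SN e) : SN (pair t e) := by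
  induction ht generalizing e with
  | intro t _ iht =>
    induction he with
    | intro e he ihe =>
      refine ⟨_, fun _ hs => ?_⟩
      cases hs with
      | pair_left _ hs => exact iht _ hs ⟨_, he⟩
      | pair_right _ hs => exact ihe _ hs

theorem cut_lam_pair {s t e : SymTm} (h : SN (cut t (.mu (cut s e.shift)))) :
    SN (cut (.lam s) (.pair t e)) := by
  generalize hw : cut t (.mu (cut s e.shift)) = w at h
  induction h generalizing s t e with
  | intro w hacc ih =>
    subst hw
    refine ⟨_, fun _ hs => ?_⟩
    cases hs with
    | cut h => cases h; exact ⟨_, hacc⟩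
    | cut_symm h => nomatch h
    | cut_left _ hs =>
      cases hs with
      | lam hs => exact ih _ (.cut_right _ (.mu (.cut_left _ hs))) rfl
    | cut_right _ hs =>
      cases hs with
      | pair_left _ hs => exact ih _ (.cut_left _ hs) rfl
      | pair_right _ hs => exact ih _ (.cut_right _ (.mu (.cut_right _ hs.shift))) rfl

end SN

/-! ### Symmetric reducibility candidates -/

/-- Values: abstractions and pairs, the terms that interact with each other through
`Contracts.lam_pair`. -/
inductive IsValue : SymTm → Prop
  | lam (t : SymTm) : IsValue (lam t)
  | pair (t e : SymTm) : IsValue (pair t e)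

theorem IsValue.step {u v : SymTm} (h : IsValue u) (hs : Step u v) : IsValue v := by
  cases h <;> cases hs <;> constructor

/-- The orthogonal of `S`: the strongly normalizing values whose cuts against the elements of `S`
are strongly normalizing. -/
def orth (S : Set SymTm) : Set SymTm := {v | IsValue v ∧ SN v ∧ ∀ w ∈ S, SN (cut v w)}

theorem orth_step {S : Set SymTm} {u v : SymTm} (h : u ∈ orth S) (hs : Step u v) : v ∈ orth S :=
  ⟨h.1.step hs, h.2.1.step hs, fun w hw => (h.2.2 w hw).step (.cut_left _ hs)⟩

theorem orth_anti {S T : Set SymTm} (h : S ⊆ T) : orth T ⊆ orth S :=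
  fun _ hv => ⟨hv.1, hv.2.1, fun w hw => hv.2.2 w (h hw)⟩

theorem mem_orth_orth {S : Set SymTm} {v : SymTm} (hv : v ∈ S) (hval : IsValue v) (hsn : SN v) :
    v ∈ orth (orth S) :=
  ⟨hval, hsn, fun _ hw => (hw.2.2 v hv).cut_comm⟩

theorem orth_subset_orth_orth_orth (S : Set SymTm) : orth S ⊆ orth (orth (orth S)) :=
  fun _ hv => mem_orth_orth hv hv.1 hv.2.1

theorem orth_orth_orth_orth (S : Set SymTm) : orth (orth (orth (orth S))) = orth (orth S) :=
  (orth_anti (orth_subset_orth_orth_orth S)).antisymm (orth_subset_orth_orth_orth (orth S))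

/-- `Saturated V Y u`: each value that `u` reduces to belongs to `V`, each `μ`-abstraction that `u`
reduces to has strongly normalizing instances at the elements of `Y`, and no reduction sequence from
`u` is infinite (the predicate being inductive). -/
inductive Saturated (V Y : Set SymTm) : SymTm → Prop
  | intro {u : SymTm} (mem_of_isValue : IsValue u → u ∈ V)
      (sn_inst : ∀ p, u = mu p → ∀ v ∈ Y, SN (p.inst v))
      (step : ∀ v, Step u v → Saturated V Y v) : Saturated V Y u

namespace Saturated

variable {V Y Z : Set SymTm} {u v p : SymTm}

theorem mem_of_isValue : Saturated V Y u → IsValue u → u ∈ V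
  | intro h _ _ => h

theorem sn_inst : Saturated V Y (mu p) → v ∈ Y → SN (p.inst v)
  | intro _ h _ => h p rfl v

theorem step : Saturated V Y u → Step u v → Saturated V Y v
  | intro _ _ h => h v

theorem sn (h : Saturated V Y u) : SN u := by
  induction h with
  | intro _ _ _ ih => exact ⟨_, ih⟩

theorem anti (hYZ : Y ⊆ Z) (h : Saturated V Z u) : Saturated V Y u := by
  induction h with
  | intro hval hmu _ ih => exact ⟨hval, fun p hp v hv => hmu p hp v (hYZ hv), ih⟩

theorem var (n : ℕ) : Saturated V Y (var n) :=
  ⟨(nomatch ·), fun _ h => (nomatch h), fun _ h => (nomatch h)⟩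

theorem of_mem_orth {S : Set SymTm} (h : u ∈ orth S) : Saturated (orth S) Y u := by
  induction h.2.1 with
  | intro u _ ih =>
    refine ⟨fun _ => h, ?_, fun v hs => ih v hs (orth_step h hs)⟩
    rintro p rfl
    exact nomatch h.1

end Saturated

/-- A symmetric reducibility candidate: sets `left` and `right` of terms, with respective sets of
values `leftValues` and `rightValues`. The values of the two sides are mutually orthogonal, and each
side consists of all terms saturated with respect to its values and to the other side. -/
structure Candidate where
  leftValues : Set SymTm
  rightValues : Set SymTm
  left : Set SymTm
  right : Set SymTm
  leftValues_eq : leftValues = orth rightValues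
  rightValues_eq : rightValues = orth leftValues
  mem_left {u : SymTm} : u ∈ left ↔ Saturated leftValues right u
  mem_right {u : SymTm} : u ∈ right ↔ Saturated rightValues left u

namespace Candidate

/-- The candidate with its two sides exchanged. -/
def symm (C : Candidate) : Candidate :=
  ⟨C.rightValues, C.leftValues, C.right, C.left, C.rightValues_eq, C.leftValues_eq, C.mem_right,
    C.mem_left⟩

variable (C D : Candidate) {t e u v w p : SymTm}

theorem sn_of_mem_left (hu : u ∈ C.left) : SN u := (C.mem_left.1 hu).sn

theorem sn_of_mem_right (hu : u ∈ C.right) : SN u := C.symm.sn_of_mem_left hu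

theorem var_mem_left (n : ℕ) : var n ∈ C.left := C.mem_left.2 (.var n)

theorem var_mem_right (n : ℕ) : var n ∈ C.right := C.symm.var_mem_left n

theorem left_step (hu : u ∈ C.left) (hs : Step u v) : v ∈ C.left :=
  C.mem_left.2 ((C.mem_left.1 hu).step hs)

theorem right_step (hu : u ∈ C.right) (hs : Step u v) : v ∈ C.right := C.symm.left_step hu hs

theorem leftValues_subset : C.leftValues ⊆ C.left := fun u hu => by
  rw [C.mem_left, C.leftValues_eq]
  exact .of_mem_orth (C.leftValues_eq ▸ hu)

theorem rightValues_subset : C.rightValues ⊆ C.right := C.symm.leftValues_subset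

theorem sn_cut_of_isValue (hu : u ∈ C.left) (hv : v ∈ C.right) (hu' : IsValue u)
    (hv' : IsValue v) : SN (cut u v) := by
  have huV : u ∈ orth C.rightValues := C.leftValues_eq ▸ (C.mem_left.1 hu).mem_of_isValue hu'
  exact huV.2.2 v ((C.mem_right.1 hv).mem_of_isValue hv')

theorem sn_of_contracts (hu : u ∈ C.left) (hv : v ∈ C.right) (h : Contracts u v w) : SN w := by
  cases h with
  | lam_pair => exact (C.sn_cut_of_isValue hu hv (.lam _) (.pair _ _)).step (.cut (.lam_pair _ _ _))
  | mu => exact (C.mem_left.1 hu).sn_inst hv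

theorem sn_cut (hu : u ∈ C.left) (hv : v ∈ C.right) : SN (cut u v) := by
  induction C.sn_of_mem_left hu generalizing v with
  | intro u _ ihu =>
    induction C.sn_of_mem_right hv with
    | intro v _ ihv =>
      refine ⟨_, fun w hs => ?_⟩
      cases hs with
      | cut h => exact C.sn_of_contracts hu hv h
      | cut_symm h => exact C.symm.sn_of_contracts hv hu h
      | cut_left _ hs => exact ihu _ hs (C.left_step hu hs) hv
      | cut_right _ hs => exact ihv _ hs (C.right_step hv hs)

theorem mem_left_of_sn_cut (h : ∀ v ∈ C.right, SN (cut u v)) : u ∈ C.left := by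
  have hsn : SN u := (h _ (C.var_mem_right 0)).of_cut_left
  rw [C.mem_left]
  induction hsn with
  | intro u hacc ih =>
    refine ⟨fun hval => ?_, ?_, fun u' hs => ih u' hs fun v hv => (h v hv).step (.cut_left _ hs)⟩
    · rw [C.leftValues_eq]
      exact ⟨hval, ⟨_, hacc⟩, fun v hv => h v (C.rightValues_subset hv)⟩
    · rintro p rfl v hv
      exact (h v hv).step (.cut (.mu p v))

theorem mu_mem_left (hp : ∀ v ∈ C.right, SN (p.inst v)) : mu p ∈ C.left := by
  have hsn : SN p := (hp _ (C.var_mem_right 0)).of_inst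
  induction hsn with
  | intro p _ ih =>
    rw [C.mem_left]
    refine ⟨(nomatch ·), ?_, fun u hs => C.mem_left.1 ?_⟩
    · rintro _ ⟨⟩
      exact hp
    · cases hs with
      | mu hs => exact ih _ hs fun v hv => (hp v hv).step (hs.subst _)
      | eta =>
        refine C.mem_left_of_sn_cut fun v hv => ?_
        have hcut : SN (cut (u.shift.inst v) v) := hp v hv
        rwa [inst_shift] at hcut
      | eta_symm =>
        refine C.mem_left_of_sn_cut fun v hv => ?_
        have hcut : SN (cut v (u.shift.inst v)) := hp v hv
        rw [inst_shift] at hcut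
        exact hcut.cut_comm

theorem mu_mem_right (hp : ∀ v ∈ C.left, SN (p.inst v)) : mu p ∈ C.right :=
  C.symm.mu_mem_left hp

/-- The monotone operator taking the left side of a pair of sides with values `V` and `W` to the
left side that its right side determines. -/
def saturationHom (V W : Set SymTm) : Set SymTm →o Set SymTm where
  toFun X := {u | Saturated V {v | Saturated W X v} u}
  monotone' _ _ h _ := .anti fun _ => .anti h

/-- The candidate generated by a set `P` of right values. The third orthogonal cannot be dropped:
`P ⊆ orth (orth P)` holds only when `P` consists of strongly normalizing values. -/
def generate (P : Set SymTm) : Candidate where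
  leftValues := orth (orth (orth P))
  rightValues := orth (orth P)
  left := (saturationHom (orth (orth (orth P))) (orth (orth P))).lfp
  right := {v | Saturated (orth (orth P))
    (saturationHom (orth (orth (orth P))) (orth (orth P))).lfp v}
  leftValues_eq := rfl
  rightValues_eq := (orth_orth_orth_orth P).symm
  mem_left := Set.ext_iff.1 (saturationHom _ _).map_lfp.symm _
  mem_right := .rfl

theorem orth_subset_generate_left (P : Set SymTm) : orth P ⊆ (generate P).left :=
  (orth_subset_orth_orth_orth P).trans (generate P).leftValues_subset

theorem mem_generate_right {P : Set SymTm} (hv : v ∈ P) (hval : IsValue v) (hsn : SN v) :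
    v ∈ (generate P).right :=
  (generate P).rightValues_subset (mem_orth_orth hv hval hsn)

/-- The candidate interpreting `A → B`, when `C` and `D` interpret `A` and `B`. -/
def arr : Candidate := generate (Set.image2 pair C.left D.right)

variable {C D}

theorem pair_mem_arr_right (ht : t ∈ C.left) (he : e ∈ D.right) : pair t e ∈ (C.arr D).right :=
  mem_generate_right (Set.mem_image2_of_mem ht he) (.pair t e)
    ((C.sn_of_mem_left ht).pair (D.sn_of_mem_right he))

theorem lam_mem_arr_left (h : ∀ v ∈ C.left, t.inst v ∈ D.left) : lam t ∈ (C.arr D).left := by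
  refine orth_subset_generate_left _ ⟨.lam t, ?_, ?_⟩
  · exact (D.sn_of_mem_left (h _ (C.var_mem_left 0))).of_inst.lam
  · rintro _ ⟨t', ht', e, he, rfl⟩
    refine (C.sn_cut ht' (C.mu_mem_right fun v hv => ?_)).cut_lam_pair
    have hcut : SN (cut (t.inst v) e) := D.sn_cut (h v hv) he
    rwa [← inst_shift e v] at hcut

end Candidate

end SymTm

open SymTm

/-! ### Interpretation of types -/

/-- The candidate interpreting a type expression: its left side consists of the terms in the role of
`l`-terms of that type, its right side of those in the role of `r`-terms. -/
def PreTy.interp {𝒜 : Type u} : {s : Calculus} → PreTy 𝒜 s → Candidate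
  | _, .atom _ => .generate ∅
  | _, .arr A B => A.interp.arr B.interp
  | _, .neg A => A.interp.symm

theorem PreTy.interp_eq {𝒜 : Type u} {s : Calculus} {A B : PreTy 𝒜 s} (h : PreTy.Rel A B) :
    A.interp = B.interp := by
  induction h with
  | neg_neg A => rfl
  | neg _ ih => simp only [PreTy.interp, ih]
  | arr_left B _ ih => simp only [PreTy.interp, ih]
  | arr_right A _ ih => simp only [PreTy.interp, ih]

namespace Ty

variable {𝒜 : Type u} {s : Calculus}

/-- The candidate interpreting a type. -/
def interp : Ty 𝒜 s → Candidate := Quot.lift PreTy.interp fun _ _ => PreTy.interp_eq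

theorem interp_arr (A B : Ty 𝒜 s) : (arr A B).interp = A.interp.arr B.interp := by
  induction A using Quot.ind
  induction B using Quot.ind
  rfl

theorem interp_neg (A : Ty 𝒜 .star) : (neg A).interp = A.interp.symm := by
  induction A using Quot.ind
  rfl

end Ty

/-! ### Erasure -/

namespace Tm

variable {s : Calculus} {k : Kind}

/-- The erasure of both negations, with `σ` and `τ` substituted for the `l`-variables and the
`r`-variables. -/
def toSym : {s : Calculus} → {k : Kind} → (σ τ : ℕ → SymTm) → Tm s k → SymTm
  | _, _, σ, τ, cut t e => .cut (toSym σ τ t) (toSym σ τ e)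
  | _, _, σ, _, lvar x => σ x
  | _, _, σ, τ, lam t => .lam (toSym (up σ) (shift ∘ τ) t)
  | _, _, σ, τ, mu p => .mu (toSym (shift ∘ σ) (up τ) p)
  | _, _, σ, τ, bar e => toSym σ τ e
  | _, _, _, τ, rvar a => τ a
  | _, _, σ, τ, app t e => .pair (toSym σ τ t) (toSym σ τ e)
  | _, _, σ, τ, mutilde p => .mu (toSym (up σ) (shift ∘ τ) p)
  | _, _, σ, τ, tilde t => toSym σ τ t

theorem subst_toSym (ξ σ τ : ℕ → SymTm) (u : Tm s k) :
    (toSym σ τ u).subst ξ = toSym (SymTm.subst ξ ∘ σ) (SymTm.subst ξ ∘ τ) u := by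
  induction u generalizing ξ σ τ <;>
    simp only [toSym, SymTm.subst, subst_up_comp_up, subst_up_comp_shift_comp, Function.comp_apply,
      *]

theorem toSym_shift_comp (σ τ : ℕ → SymTm) (u : Tm s k) :
    toSym (shift ∘ σ) (shift ∘ τ) u = (toSym σ τ u).shift := by
  rw [shift_eq_subst, subst_toSym, ← funext shift_eq_subst]

theorem toSym_rename (σ τ : ℕ → SymTm) (ρ θ : ℕ → ℕ) (u : Tm s k) :
    toSym σ τ (rename ρ θ u) = toSym (σ ∘ ρ) (τ ∘ θ) u := by
  induction u generalizing σ τ ρ θ <;>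
    simp only [toSym, rename, up_comp_upRen, Function.comp_assoc, Function.comp_apply, *]

theorem toSym_shiftL (σ τ : ℕ → SymTm) (u : Tm s k) :
    toSym (up σ) (shift ∘ τ) (shiftL u) = (toSym σ τ u).shift := by
  rw [shiftL, toSym_rename, ← toSym_shift_comp]; rfl

theorem toSym_shiftR (σ τ : ℕ → SymTm) (u : Tm s k) :
    toSym (shift ∘ σ) (up τ) (shiftR u) = (toSym σ τ u).shift := by
  rw [shiftR, toSym_rename, ← toSym_shift_comp]; rfl

theorem toSym_comp_shiftL (σ τ : ℕ → SymTm) (f : ℕ → Tm s k) :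
    (toSym (up σ) (shift ∘ τ) ∘ fun n => shiftL (f n)) = shift ∘ toSym σ τ ∘ f :=
  funext fun n => toSym_shiftL σ τ (f n)

theorem toSym_comp_shiftR (σ τ : ℕ → SymTm) (f : ℕ → Tm s k) :
    (toSym (shift ∘ σ) (up τ) ∘ fun n => shiftR (f n)) = shift ∘ toSym σ τ ∘ f :=
  funext fun n => toSym_shiftR σ τ (f n)

theorem toSym_comp_scons (σ τ : ℕ → SymTm) (u : Tm s k) (f : ℕ → Tm s k) :
    toSym σ τ ∘ scons u f = SymTm.scons (toSym σ τ u) (toSym σ τ ∘ f) := by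
  funext n; cases n <;> rfl

theorem toSym_subst (σ τ : ℕ → SymTm) (σ' : ℕ → Tm s .l) (τ' : ℕ → Tm s .r) (u : Tm s k) :
    toSym σ τ (subst σ' τ' u) = toSym (toSym σ τ ∘ σ') (toSym σ τ ∘ τ') u := by
  induction u generalizing σ τ with
  | cut _ _ iht ihe => simp only [subst, toSym, iht, ihe]
  | lvar | rvar => rfl
  | lam _ ih => simp only [subst, toSym, ih, toSym_comp_scons, toSym_comp_shiftL]; rfl
  | mu _ ih => simp only [subst, toSym, ih, toSym_comp_scons, toSym_comp_shiftR]; rfl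
  | bar _ ih => exact ih σ τ σ' τ'
  | app _ _ iht ihe => simp only [subst, toSym, iht, ihe]
  | mutilde _ ih => simp only [subst, toSym, ih, toSym_comp_scons, toSym_comp_shiftL]; rfl
  | tilde _ ih => exact ih σ τ σ' τ'

theorem inst_toSym_up_left (σ τ : ℕ → SymTm) (u : Tm s k) (v : SymTm) :
    (toSym (up σ) (shift ∘ τ) u).inst v = toSym (SymTm.scons v σ) τ u := by
  rw [← inst_comp_up, inst, subst_toSym]
  congr 1
  exact funext fun n => inst_shift (τ n) v

theorem inst_toSym_up_right (σ τ : ℕ → SymTm) (u : Tm s k) (v : SymTm) :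
    (toSym (shift ∘ σ) (up τ) u).inst v = toSym σ (SymTm.scons v τ) u := by
  rw [← inst_comp_up, inst, subst_toSym]
  congr 1
  exact funext fun n => inst_shift (σ n) v

theorem toSym_instL (σ τ : ℕ → SymTm) (u : Tm s k) (t : Tm s .l) :
    toSym σ τ (instL u t) = (toSym (up σ) (shift ∘ τ) u).inst (toSym σ τ t) := by
  rw [inst_toSym_up_left, instL, toSym_subst, toSym_comp_scons]; rfl

theorem toSym_instR (σ τ : ℕ → SymTm) (u : Tm s k) (e : Tm s .r) :
    toSym σ τ (instR u e) = (toSym (shift ∘ σ) (up τ) u).inst (toSym σ τ e) := by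
  rw [inst_toSym_up_right, instR, toSym_subst, toSym_comp_scons]; rfl

end Tm

section Simulation

variable {s : Calculus} {k : Kind} {u v : Tm s k}

open Tm in
theorem Root.toSym (h : Root u v) (σ τ : ℕ → SymTm) :
    SymTm.Step (u.toSym σ τ) (v.toSym σ τ) ∨
      Swap (u.toSym σ τ) (v.toSym σ τ) ∧ sizeOf v < sizeOf u := by
  cases h with
  | lam t t' e => simp only [Tm.toSym, toSym_shiftL]; exact .inl (.cut (.lam_pair _ _ _))
  | mu p e => rw [toSym_instR]; exact .inl (.cut (.mu _ _))
  | mutilde t p => rw [toSym_instL]; exact .inl (.cut_symm (.mu _ _))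
  | sl t => simp only [Tm.toSym, toSym_shiftR]; exact .inl (.eta _)
  | sr e => simp only [Tm.toSym, toSym_shiftL]; exact .inl (.eta_symm _)
  | cl1l t => exact .inr ⟨.refl _, by simp +arith⟩
  | cl1r e => exact .inr ⟨.refl _, by simp +arith⟩
  | cl2 t e => exact .inr ⟨.exch (.refl _) (.refl _), by simp +arith⟩

theorem Step.toSym (h : Step u v) (σ τ : ℕ → SymTm) :
    SymTm.Step (u.toSym σ τ) (v.toSym σ τ) ∨
      Swap (u.toSym σ τ) (v.toSym σ τ) ∧ sizeOf v < sizeOf u := by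
  induction h generalizing σ τ with
  | root h => exact h.toSym σ τ
  | cut_left e _ ih => exact (ih σ τ).imp (.cut_left _) (.imp (.cut · (.refl _)) (by simp))
  | cut_right t _ ih => exact (ih σ τ).imp (.cut_right _) (.imp (.cut (.refl _)) (by simp))
  | lam _ ih => exact (ih _ _).imp .lam (.imp .lam (by simp))
  | mu _ ih => exact (ih _ _).imp .mu (.imp .mu (by simp))
  | bar _ ih => exact (ih σ τ).imp id (.imp id (by simp))
  | app_left e _ ih => exact (ih σ τ).imp (.pair_left _) (.imp (.pair · (.refl _)) (by simp))
  | app_right t _ ih => exact (ih σ τ).imp (.pair_right _) (.imp (.pair (.refl _)) (by simp))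
  | mutilde _ ih => exact (ih _ _).imp .mu (.imp .mu (by simp))
  | tilde _ ih => exact (ih σ τ).imp id (.imp id (by simp))

theorem stronglyNormalizable_iff_acc :
    StronglyNormalizable u ↔ Acc (fun v u : Tm s k => Step u v) u := by
  rw [acc_iff_isEmpty_descending_chain, isEmpty_subtype, StronglyNormalizable, not_exists]

theorem stronglyNormalizable_of_sn_toSym {σ τ : ℕ → SymTm} (h : SN (u.toSym σ τ)) :
    StronglyNormalizable u := by
  refine stronglyNormalizable_iff_acc.2
    (acc_of_simulation (fun u w => Swap (u.toSym σ τ) w) sizeOf (fun {u v w} huw hs => ?_) h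
      (.refl _))
  exact (hs.toSym σ τ).imp (Swap.exists_step · huw) (.imp_left fun huv => huv.symm.trans huw)

end Simulation

/-! ### Adequacy -/

/-- The environment `σ` maps each variable declared in `Γ` into the set that `I` assigns to its
type. -/
def Realizes {X : Type u} (I : X → Set SymTm) (Γ : List X) (σ : ℕ → SymTm) : Prop :=
  ∀ n A, Γ[n]? = some A → σ n ∈ I A

theorem Realizes.cons {X : Type u} {I : X → Set SymTm} {Γ : List X} {σ : ℕ → SymTm}
    (h : Realizes I Γ σ) {A : X} {v : SymTm} (hv : v ∈ I A) :
    Realizes I (A :: Γ) (SymTm.scons v σ)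
  | 0, _, rfl => hv
  | n + 1, B, hB => h n B hB

section Adequacy

variable {𝒜 : Type u}

mutual

theorem TypedL.toSym_mem {s : Calculus} {Γ Δ : Ctx 𝒜 s} {t : Tm s .l} {A : Ty 𝒜 s} :
    TypedL Γ t A Δ → ∀ {σ τ : ℕ → SymTm}, Realizes (·.interp.left) Γ σ →
      Realizes (·.interp.right) Δ τ → t.toSym σ τ ∈ A.interp.left
  | .var h, _, _, hσ, _ => hσ _ _ h
  | .lam h, _, _, hσ, hτ => by
      rw [Ty.interp_arr]
      refine Candidate.lam_mem_arr_left fun v hv => ?_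
      rw [Tm.inst_toSym_up_left]
      exact h.toSym_mem (hσ.cons hv) hτ
  | .mu h, _, _, hσ, hτ => Candidate.mu_mem_left _ fun v hv => by
      rw [Tm.inst_toSym_up_right]
      exact h.sn_toSym hσ (hτ.cons hv)
  | .bar h, _, _, hσ, hτ => by
      rw [Ty.interp_neg]
      exact h.toSym_mem hσ hτ

theorem TypedR.toSym_mem {s : Calculus} {Γ Δ : Ctx 𝒜 s} {e : Tm s .r} {A : Ty 𝒜 s} :
    TypedR Γ e A Δ → ∀ {σ τ : ℕ → SymTm}, Realizes (·.interp.left) Γ σ →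
      Realizes (·.interp.right) Δ τ → e.toSym σ τ ∈ A.interp.right
  | .var h, _, _, _, hτ => hτ _ _ h
  | .app ht he, _, _, hσ, hτ => by
      rw [Ty.interp_arr]
      exact Candidate.pair_mem_arr_right (ht.toSym_mem hσ hτ) (he.toSym_mem hσ hτ)
  | .mutilde h, _, _, hσ, hτ => Candidate.mu_mem_right _ fun v hv => by
      rw [Tm.inst_toSym_up_left]
      exact h.sn_toSym (hσ.cons hv) hτ
  | .tilde h, _, _, hσ, hτ => by
      rw [Ty.interp_neg]
      exact h.toSym_mem hσ hτ

theorem TypedC.sn_toSym {s : Calculus} {Γ Δ : Ctx 𝒜 s} {p : Tm s .c} :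
    TypedC p Γ Δ → ∀ {σ τ : ℕ → SymTm}, Realizes (·.interp.left) Γ σ →
      Realizes (·.interp.right) Δ τ → SN (p.toSym σ τ)
  | .cut ht he, _, _, hσ, hτ => Candidate.sn_cut _ (ht.toSym_mem hσ hτ) (he.toSym_mem hσ hτ)

end

variable {s : Calculus}

theorem realizes_left_var (Γ : Ctx 𝒜 s) : Realizes (·.interp.left) Γ var :=
  fun n A _ => A.interp.var_mem_left n

theorem realizes_right_var (Δ : Ctx 𝒜 s) : Realizes (·.interp.right) Δ var :=
  fun n A _ => A.interp.var_mem_right n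

variable (𝒜 s) in
theorem calculusStronglyNormalizable : CalculusStronglyNormalizable 𝒜 s := by
  refine ⟨fun Γ Δ t A h => ?_, fun Γ Δ e A h => ?_, fun Γ Δ p h => ?_⟩ <;>
    apply stronglyNormalizable_of_sn_toSym (σ := var) (τ := var)
  · exact A.interp.sn_of_mem_left (h.toSym_mem (realizes_left_var Γ) (realizes_right_var Δ))
  · exact A.interp.sn_of_mem_right (h.toSym_mem (realizes_left_var Γ) (realizes_right_var Δ))
  · exact h.sn_toSym (realizes_left_var Γ) (realizes_right_var Δ)

end Adequacy

end LMM

/-- The typed `λμμ̃*`-calculus is strongly normalizable, and so is the typed `λμμ̃`-calculus. -/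
theorem mainTheorem4 (𝒜 : Type*) :
    LMM.CalculusStronglyNormalizable 𝒜 LMM.Calculus.star ∧
      LMM.CalculusStronglyNormalizable 𝒜 LMM.Calculus.base :=
  ⟨LMM.calculusStronglyNormalizable 𝒜 _, LMM.calculusStronglyNormalizable 𝒜 _⟩
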